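/- For a topological space $X$ let $\mathcal O_X$ be the collection of all covers of $X$ by open sets, $\Delta_X$ the collection of all covers of $X$ by open dense sets, and $\mathcal D_X$ the collection of all families of subsets of $X$ whose union is dense in $X$. For collections $\mathcal A,\mathcal B$ of families of subsets of $X$, let $\mathsf{S}_1(\mathcal A,\mathcal B)$ be the assertion that for each sequence $\langle \mathcal U_n : n\in\omega\rangle$ of members of $\mathcal A$ there are $U_n\in\mathcal U_n$ with $\{U_n : n\in\omega\}\in\mathcal B$, and let $\mathsf{U}_{\mathrm{fin}}(\mathcal A,\mathcal B)$ be the assertion that for each such sequence there are finite $\mathcal F_n\subset\mathcal U_n$ with $\{\bigcup\mathcal F_n : n\in\omega\}\in\mathcal B$. The space $X$ is Menger if $\mathsf{U}_{\mathrm{fin}}(\mathcal O_X,\mathcal O_X)$ holds, and od-Menger if $\mathsf{U}_{\mathrm{fin}}(\Delta_X,\mathcal O_X)$ holds. It is $0$-dimensional if its clopen subsets form a base. Let $\omega+1$ be the convergent sequence space, that is, the one-point compactification of the discrete space $\omega$. Corollary 3.5. Assume the continuum hypothesis $2^{\aleph_0}=\aleph_1$. Then there are a subset $E$ of $\mathbb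 R$ and a topology on $E$, finer than the Euclidean subspace topology, such that $E$ with this topology is hereditarily Lindelöf, $0$-dimensional and first countable, and: (1) $E$ satisfies $\mathsf{S}_1(\Delta_E,\mathcal O_E)$, hence is od-Menger, but does not satisfy $\mathsf{U}_{\mathrm{fin}}(\mathcal O_E,\mathcal D_E)$, hence is not Menger; (2) $E\times(\omega+1)$ (with the product topology) is Lindelöf and is the union of two od-Menger subspaces, but is not od-Menger. -/

import Mathlib

open Set

/-- `𝒪_X`: the collection of all covers of `X` by open sets. -/
def openCovers (X : Type*) [TopologicalSpace X] : Set (Set (Set X)) :=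
  {𝒰 | (∀ U ∈ 𝒰, IsOpen U) ∧ ⋃₀ 𝒰 = univ}

/-- `Δ_X`: the collection of all od-covers of `X`, that is covers by open dense sets. -/
def odCovers (X : Type*) [TopologicalSpace X] : Set (Set (Set X)) :=
  {𝒰 | 𝒰 ∈ openCovers X ∧ ∀ U ∈ 𝒰, Dense U}

/-- `𝒟_X`: the collection of all weak covers of `X`, that is families of subsets of `X`
whose union is dense. -/
def weakCovers (X : Type*) [TopologicalSpace X] : Set (Set (Set X)) :=
  {𝒰 | Dense (⋃₀ 𝒰)}

/-- The selection principle `U_fin(𝒜, ℬ)`. -/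
def Ufin {X : Type*} (𝒜 ℬ : Set (Set (Set X))) : Prop :=
  ∀ 𝒰 : ℕ → Set (Set X), (∀ n, 𝒰 n ∈ 𝒜) →
    ∃ ℱ : ℕ → Set (Set X), (∀ n, (ℱ n).Finite ∧ ℱ n ⊆ 𝒰 n) ∧ range (fun n => ⋃₀ ℱ n) ∈ ℬ

/-- The selection principle `S_1(𝒜, ℬ)`. -/
def SOne {X : Type*} (𝒜 ℬ : Set (Set (Set X))) : Prop :=
  ∀ 𝒰 : ℕ → Set (Set X), (∀ n, 𝒰 n ∈ 𝒜) →
    ∃ U : ℕ → Set X, (∀ n, U n ∈ 𝒰 n) ∧ range U ∈ ℬ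

/-- Menger spaces. -/
def IsMengerSpace (X : Type*) [TopologicalSpace X] : Prop :=
  Ufin (openCovers X) (openCovers X)

/-- od-Menger spaces. -/
def IsODMengerSpace (X : Type*) [TopologicalSpace X] : Prop :=
  Ufin (odCovers X) (openCovers X)

/-- A space is `0`-dimensional if its clopen subsets form a base. (The `T₁` axiom is not part of
this definition; it is automatic for topologies finer than a Euclidean one.) -/
def IsZeroDimensional (X : Type*) [TopologicalSpace X] : Prop :=
  TopologicalSpace.IsTopologicalBasis {U : Set X | IsClopen U}

/-! Under CH, `E` is a dense Luzin set for the Hechler topology, carried injectively into the reals.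
This topology is Baire (`exists_mem_cone_forall_mem`) and has a strong countable chain condition
(`exists_countable_iUnion_subset_closure`), so dense open sets can be diagonalised against in ω₁
steps. In a Luzin set every dense open set is co-countable, which gives `SOne` for od-covers. Yet
finite selections from the covers by the value of the `n`-th coordinate are bounded, so they miss a
whole cone, which meets `E`. In `E × OnePoint ℕ` the non-limit layers form a dense open set; adding
it to each member turns those covers into od-covers without changing them on the limit layer. -/

/-- The Baire space `ω ^ ω`, to be given the topology of Hechler forcing. -/
def Hechler : Type := ℕ → ℕ

/-! ### The Hechler topology and its Luzin sets. -/

namespace Hechler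

/-- The basic neighbourhoods of `x`: the points above `x` which agree with `x` below `n`. -/
def cone (x : Hechler) (n : ℕ) : Set Hechler :=
  {y | (∀ i < n, y i = x i) ∧ ∀ i, x i ≤ y i}

theorem mem_cone_self (x : Hechler) (n : ℕ) : x ∈ cone x n :=
  ⟨fun _ _ => rfl, fun _ => le_rfl⟩

theorem cone_subset_cone {x y : Hechler} {m n : ℕ} (h : y ∈ cone x n) (hmn : n ≤ m) :
    cone y m ⊆ cone x n := fun _ hz =>
  ⟨fun i hi => (hz.1 i (hi.trans_le hmn)).trans (h.1 i hi), fun i => (h.2 i).trans (hz.2 i)⟩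

/-- The topology of Hechler forcing on `ω ^ ω`. -/
instance : TopologicalSpace Hechler where
  IsOpen U := ∀ x ∈ U, ∃ n, cone x n ⊆ U
  isOpen_univ := fun _ _ => ⟨0, subset_univ _⟩
  isOpen_inter := fun U V hU hV x hx => by
    obtain ⟨m, hm⟩ := hU x hx.1
    obtain ⟨n, hn⟩ := hV x hx.2
    exact ⟨max m n, subset_inter
      ((cone_subset_cone (mem_cone_self x m) (le_max_left m n)).trans hm)
      ((cone_subset_cone (mem_cone_self x n) (le_max_right m n)).trans hn)⟩
  isOpen_sUnion := fun 𝒰 h𝒰 x ⟨U, hU, hx⟩ =>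
    (h𝒰 U hU x hx).imp fun _ hn => hn.trans (subset_sUnion_of_mem hU)

theorem isOpen_iff {U : Set Hechler} : IsOpen U ↔ ∀ x ∈ U, ∃ n, cone x n ⊆ U := Iff.rfl

theorem isOpen_cone (x : Hechler) (n : ℕ) : IsOpen (cone x n) :=
  fun _ hy => ⟨n, cone_subset_cone hy le_rfl⟩

theorem isClosed_cone (x : Hechler) (n : ℕ) : IsClosed (cone x n) := by
  rw [← isOpen_compl_iff, isOpen_iff]
  intro y hy
  have key : (∃ i < n, y i ≠ x i) ∨ ∃ i, y i < x i := by
    by_contra! h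
    exact hy h
  obtain ⟨i, hi, hne⟩ | ⟨i, hlt⟩ := key
  · exact ⟨i + 1, fun z hz hzx => hne ((hz.1 i i.lt_succ_self).symm.trans (hzx.1 i hi))⟩
  · refine ⟨i + 1, fun z hz hzx => hlt.not_ge ?_⟩
    rw [← hz.1 i i.lt_succ_self]
    exact hzx.2 i

theorem isTopologicalBasis_cone :
    TopologicalSpace.IsTopologicalBasis {U : Set Hechler | ∃ x n, U = cone x n} := by
  refine TopologicalSpace.isTopologicalBasis_of_isOpen_of_nhds ?_ fun x U hx hU => ?_
  · rintro _ ⟨x, n, rfl⟩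
    exact isOpen_cone x n
  · obtain ⟨n, hn⟩ := isOpen_iff.1 hU x hx
    exact ⟨_, ⟨x, n, rfl⟩, mem_cone_self x n, hn⟩

theorem hasBasis_nhds (x : Hechler) : (nhds x).HasBasis (fun _ : ℕ => True) (cone x) := by
  refine ⟨fun U => ⟨fun hU => ?_, fun ⟨n, _, hn⟩ =>
    Filter.mem_of_superset ((isOpen_cone x n).mem_nhds (mem_cone_self x n)) hn⟩⟩
  obtain ⟨V, hVU, hV, hx⟩ := mem_nhds_iff.1 hU
  obtain ⟨n, hn⟩ := isOpen_iff.1 hV x hx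
  exact ⟨n, trivial, hn.trans hVU⟩

instance : FirstCountableTopology Hechler :=
  ⟨fun x => (hasBasis_nhds x).isCountablyGenerated⟩

/-- The Hechler topology refines the product topology. -/
theorem continuous_coord (n : ℕ) : Continuous fun x : Hechler => x n := by
  refine continuous_discrete_rng.2 fun k => isOpen_iff.2 fun x hx => ⟨n + 1, fun y hy => ?_⟩
  exact (hy.1 n n.lt_succ_self).trans hx

/-- Baire category by fusion: the stems of shrinking cones grow, so each coordinate stabilises and
the diagonal point lies in all the cones. -/
theorem exists_mem_cone_forall_mem {D : ℕ → Set Hechler} (hD : ∀ k, IsOpen (D k))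
    (hd : ∀ k, Dense (D k)) (x : Hechler) (n : ℕ) : ∃ y ∈ cone x n, ∀ k, y ∈ D k := by
  have step : ∀ (k : ℕ) (p : Hechler × ℕ), ∃ q : Hechler × ℕ,
      q.1 ∈ cone p.1 p.2 ∧ p.2 < q.2 ∧ cone q.1 q.2 ⊆ D k := by
    rintro k ⟨x, n⟩
    obtain ⟨y, hy, hyD⟩ := (hd k).inter_open_nonempty _ (isOpen_cone x n) ⟨x, mem_cone_self x n⟩
    obtain ⟨m, hm⟩ := isOpen_iff.1 (hD k) y hyD
    exact ⟨(y, max m (n + 1)), hy, by simp,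
      (cone_subset_cone (mem_cone_self y m) (le_max_left _ _)).trans hm⟩
  choose next hmem hlt hsub using step
  let p : ℕ → Hechler × ℕ := fun k => Nat.rec (x, n) next k
  have hp : ∀ k, p (k + 1) = next k (p k) := fun _ => rfl
  have hk : ∀ k, k ≤ (p k).2 := by
    intro k
    induction k with
    | zero => exact Nat.zero_le _
    | succ k ih => rw [hp]; exact Nat.succ_le_of_lt (ih.trans_lt (hlt k _))
  have hanti : Antitone fun k => cone (p k).1 (p k).2 := antitone_nat_of_succ_le fun k => by
    rw [hp]
    exact cone_subset_cone (hmem k _) (hlt k _).le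
  have hjk : ∀ k j, k ≤ j → (p j).1 ∈ cone (p k).1 (p k).2 :=
    fun k j h => hanti h (mem_cone_self _ _)
  let y : Hechler := fun i => (p (i + 1)).1 i
  have hy : ∀ i j, i + 1 ≤ j → y i = (p j).1 i := fun i j h =>
    ((hjk _ _ h).1 i (hk (i + 1))).symm
  have hyp : ∀ k, y ∈ cone (p k).1 (p k).2 := by
    refine fun k => ⟨fun i hi => ?_, fun i => ?_⟩ <;>
      rw [hy i (max k (i + 1)) (le_max_right _ _)]
    · exact (hjk k _ (le_max_left _ _)).1 i hi
    · exact (hjk k _ (le_max_left _ _)).2 i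
  exact ⟨y, hyp 0, fun k => hsub k (p k) (hyp (k + 1))⟩

/-- A strong form of the countable chain condition for the Hechler topology. -/
theorem exists_countable_iUnion_subset_closure {ι : Type*} {U : ι → Set Hechler}
    (hU : ∀ i, IsOpen (U i)) :
    ∃ t : Set ι, t.Countable ∧ ⋃ i, U i ⊆ closure (⋃ i ∈ t, U i) := by
  classical
  let P : List ℕ → ι → Prop := fun l i =>
    ∃ (x : Hechler) (n : ℕ), (List.range n).map x = l ∧ cone x n ⊆ U i
  -- There are only countably many stems; one index is kept for each stem that occurs.
  refine ⟨range fun l : {l // ∃ i, P l i} => l.2.choose, countable_range _, fun x hx => ?_⟩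
  obtain ⟨i, hi⟩ := mem_iUnion.1 hx
  refine (mem_closure_iff_nhds_basis (hasBasis_nhds x)).2 fun n _ => ?_
  obtain ⟨m, hm⟩ := isOpen_iff.1 (hU i) x hi
  have hcone : cone x (max m n) ⊆ U i :=
    (cone_subset_cone (mem_cone_self x m) (le_max_left _ _)).trans hm
  let l : {l // ∃ i, P l i} := ⟨(List.range (max m n)).map x, i, x, _, rfl, hcone⟩
  obtain ⟨x', n', hl, hsub⟩ := l.2.choose_spec
  have hn' : n' = max m n :=
    (List.length_range.symm.trans (List.length_map x').symm).trans
      ((congrArg List.length hl).trans ((List.length_map x).trans List.length_range))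
  subst hn'
  have hag : ∀ j < max m n, x' j = x j := fun j hj =>
    List.map_inj_left.1 hl j (List.mem_range.2 hj)
  -- Cones with the same stem meet, at the pointwise maximum.
  refine ⟨fun j => max (x j) (x' j), mem_biUnion (mem_range_self l) (hsub ⟨fun j hj => ?_,
    fun j => le_max_right _ _⟩), fun j hj => ?_, fun j => le_max_left _ _⟩
  · simp [hag j hj]
  · simp [hag j (lt_max_of_lt_right hj)]

/-- Under the continuum hypothesis the Hechler topology has a dense Luzin set. -/
theorem exists_luzin_set (CH : Cardinal.continuum.{0} = Cardinal.aleph 1) :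
    ∃ S : Set Hechler, (∀ D, IsOpen D → Dense D → (S \ D).Countable) ∧
      ∀ x n, (S ∩ cone x n).Nonempty := by
  let I := (Cardinal.aleph.{0} 1).ord.ToType
  -- By CH, ω₁ indexes all sequences of cones. Constant sequences will make the Luzin set dense.
  obtain ⟨c⟩ : Nonempty (I ≃ (ℕ → (ℕ → ℕ) × ℕ)) := by
    rw [← Cardinal.eq]
    simp [I, ← CH]
  have hIio : ∀ a : I, (Iio a).Countable := fun a => by
    have := (Cardinal.mk_Iio_lt a (by simp [I])).trans_eq (Cardinal.mk_ord_toType _)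
    exact Cardinal.le_aleph0_iff_set_countable.1
      (Order.lt_succ_iff.1 (this.trans_eq Cardinal.succ_aleph0.symm))
  let O : I → Set Hechler := fun a => ⋃ k, cone (c a k).1 (c a k).2
  have hO : ∀ a, IsOpen (O a) := fun a => isOpen_iUnion fun k => isOpen_cone _ _
  have pick : ∀ a : I, ∃ y ∈ cone (c a 0).1 (c a 0).2, ∀ b ≤ a, Dense (O b) → y ∈ O b := by
    intro a
    have ha : (Iic a).Countable := by
      rw [← Iio_insert]
      exact (hIio a).insert a
    obtain ⟨e, he⟩ := ha.exists_eq_range ⟨a, self_mem_Iic⟩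
    classical
    obtain ⟨y, hy, hyD⟩ := exists_mem_cone_forall_mem
      (D := fun k => if Dense (O (e k)) then O (e k) else univ)
      (fun k => by split_ifs; exacts [hO _, isOpen_univ])
      (fun k => by split_ifs with h; exacts [h, dense_univ]) (c a 0).1 (c a 0).2
    refine ⟨y, hy, fun d hd hdense => ?_⟩
    obtain ⟨k, rfl⟩ : d ∈ range e := he ▸ hd
    simpa [hdense] using hyD k
  choose y hy hyO using pick
  refine ⟨range y, fun D hD hd => ?_, fun x n =>
    ⟨y (c.symm fun _ => (x, n)), mem_range_self _, by simpa using hy (c.symm fun _ => (x, n))⟩⟩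
  -- A countable union of cones inside `D` is already dense. It is `O a` for some `a`, so only
  -- points with index below `a` can escape `D`.
  obtain ⟨t, ht, htD⟩ := exists_countable_iUnion_subset_closure
    (U := fun p : {p : (ℕ → ℕ) × ℕ // cone p.1 p.2 ⊆ D} => cone p.1.1 p.1.2)
    fun p => isOpen_cone _ _
  have hdense : Dense (⋃ p ∈ t, cone p.1.1 p.1.2) := by
    refine dense_closure.1 (hd.mono (Subset.trans (fun x hx => ?_) htD))
    obtain ⟨n, hn⟩ := isOpen_iff.1 hD x hx
    exact mem_iUnion.2 ⟨⟨(x, n), hn⟩, mem_cone_self x n⟩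
  have htne : t.Nonempty := by
    obtain ⟨x, hx⟩ := hdense.nonempty_iff.2 ⟨(fun _ => 0 : ℕ → ℕ)⟩
    obtain ⟨p, hp, -⟩ := mem_iUnion₂.1 hx
    exact ⟨p, hp⟩
  obtain ⟨e, rfl⟩ := ht.exists_eq_range htne
  let a : I := c.symm fun k => (e k).1
  have hOa : O a = ⋃ p ∈ range e, cone p.1.1 p.1.2 := by simp [O, a]
  have haD : O a ⊆ D := by
    rw [hOa]
    exact iUnion₂_subset fun p _ => p.2
  refine ((hIio a).image y).mono ?_
  rintro _ ⟨⟨b, rfl⟩, hbD⟩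
  exact mem_image_of_mem y (lt_of_not_ge fun hab => hbD (haD (hyO b a hab (hOa ▸ hdense))))

/-- The Baire space admits a continuous injection into the reals. -/
theorem exists_continuous_injective_real :
    ∃ f : Hechler → ℝ, Continuous f ∧ Function.Injective f := by
  obtain ⟨g, -, hg, hinj⟩ :=
    (PerfectSpace.univ_perfect ℝ).exists_nat_bool_injection univ_nonempty
  -- The characteristic function of the graph of `x` codes it in Cantor space.
  refine ⟨fun x => g fun n => decide (x n.unpair.1 = n.unpair.2), hg.comp ?_, fun x y hxy => ?_⟩
  · exact continuous_pi fun n =>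
      (continuous_of_discreteTopology (f := fun k : ℕ => decide (k = n.unpair.2))).comp
        (continuous_coord n.unpair.1)
  · funext i
    have := congrFun (hinj hxy) (Nat.pair i (y i))
    simpa using this

/-! ### Spaces with the topology induced from a Luzin set. -/

variable {E : Type*} {φ : E → Hechler}

/-- The boundary of an open set is the complement of a dense open set. -/
theorem countable_preimage_closure_diff
    (hL : ∀ D, IsOpen D → Dense D → (φ ⁻¹' Dᶜ).Countable) {O : Set Hechler} (hO : IsOpen O) :
    (φ ⁻¹' (closure O \ O)).Countable := by
  have hd : Dense (O ∪ (closure O)ᶜ) := by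
    intro x
    rw [closure_union]
    by_cases hx : x ∈ closure O
    · exact Or.inl hx
    · exact Or.inr (subset_closure hx)
  refine (hL _ (hO.union isClosed_closure.isOpen_compl) hd).mono ?_
  rintro e ⟨hcl, hnot⟩ (h | h)
  exacts [hnot h, h hcl]

variable [TopologicalSpace E]

theorem isZeroDimensional_of_isInducing (hφ : Topology.IsInducing φ) : IsZeroDimensional E := by
  have hb := isTopologicalBasis_cone.isInducing hφ
  refine hb.of_isOpen_of_subset (fun _ hU => hU.isOpen) ?_
  rintro _ ⟨_, ⟨x, n, rfl⟩, rfl⟩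
  exact ⟨(isClosed_cone x n).preimage hφ.continuous, (isOpen_cone x n).preimage hφ.continuous⟩

theorem countable_compl_of_dense (hφ : Topology.IsInducing φ)
    (hL : ∀ D, IsOpen D → Dense D → (φ ⁻¹' Dᶜ).Countable) {D : Set E} (hD : IsOpen D)
    (hd : Dense D) : Dᶜ.Countable := by
  obtain ⟨O, hO, rfl⟩ := hφ.isOpen_iff.1 hD
  refine (countable_preimage_closure_diff hL hO).mono ?_
  exact fun e he => ⟨hφ.continuous.closure_preimage_subset O (hd e), he⟩

/-- A countable subfamily is dense in the whole union; the points it misses lie on a boundary, so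
they are countable and are covered one by one. -/
theorem hereditarilyLindelofSpace (hφ : Topology.IsInducing φ)
    (hL : ∀ D, IsOpen D → Dense D → (φ ⁻¹' Dᶜ).Countable) : HereditarilyLindelofSpace E := by
  refine ⟨fun s _ => isLindelof_of_countable_subcover fun U hU hs => ?_⟩
  choose O hO hOU using fun i => hφ.isOpen_iff.1 (hU i)
  obtain ⟨t, ht, hcl⟩ := exists_countable_iUnion_subset_closure hO
  have hc := countable_preimage_closure_diff hL (isOpen_biUnion fun i (_ : i ∈ t) => hO i)
  have hidx : ∀ e : s, ∃ i, (e : E) ∈ U i := fun e => mem_iUnion.1 (hs e.2)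
  choose f hf using hidx
  let r : Set s := {e | φ e ∈ closure (⋃ i ∈ t, O i) \ ⋃ i ∈ t, O i}
  have hr : r.Countable := hc.preimage Subtype.val_injective
  refine ⟨t ∪ f '' r, ht.union (hr.image f), fun e he => ?_⟩
  by_cases h : φ e ∈ ⋃ i ∈ t, O i
  · obtain ⟨i, hi, hei⟩ := mem_iUnion₂.1 h
    exact mem_biUnion (Or.inl hi) (by rw [← hOU i]; exact hei)
  · refine mem_biUnion (Or.inr (mem_image_of_mem f (?_ : (⟨e, he⟩ : s) ∈ r))) (hf ⟨e, he⟩)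
    obtain ⟨i, hi⟩ := mem_iUnion.1 (hs he)
    exact ⟨hcl (mem_iUnion.2 ⟨i, by rw [← hOU i] at hi; exact hi⟩), h⟩

/-- Finitely many members of each of the countable families `W n` miss, for all points of some
nonempty open set at once, the member that the point selects. -/
theorem exists_cone_forall_ne {X : Type*} {ℱ : ℕ → Set (Set X)}
    (hfin : ∀ n, (ℱ n).Finite) {W : ℕ → ℕ → Set X} (hsub : ∀ n, ℱ n ⊆ range (W n)) :
    ∃ x : Hechler, ∀ y ∈ cone x 0, ∀ n, ∀ V ∈ ℱ n, ∃ k, k ≠ y n ∧ W n k = V := by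
  choose k hk using fun n (V : ℱ n) => hsub n V.2
  have hbdd : ∀ n, BddAbove (range (k n)) := fun n =>
    have := (hfin n).to_subtype
    (finite_range (k n)).bddAbove
  choose b hb using hbdd
  exact ⟨fun n => b n + 1, fun y hy n V hV => ⟨k n ⟨V, hV⟩,
    ((Nat.lt_succ_of_le (hb n (mem_range_self ⟨V, hV⟩))).trans_le (hy.2 n)).ne, hk n ⟨V, hV⟩⟩⟩

end Hechler

/-! ### Selection principles in general spaces. -/

section Selection

variable {X Y : Type*}

theorem SOne.ufin {𝒜 ℬ : Set (Set (Set X))} (h : SOne 𝒜 ℬ) : Ufin 𝒜 ℬ := fun 𝒰 h𝒰 => by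
  obtain ⟨U, hU, hr⟩ := h 𝒰 h𝒰
  exact ⟨fun n => {U n}, fun n => ⟨finite_singleton _, singleton_subset_iff.2 (hU n)⟩,
    by simpa using hr⟩

theorem Ufin.of_subset {𝒜 ℬ 𝒞 : Set (Set (Set X))} (h : Ufin 𝒜 ℬ) (hs : ℬ ⊆ 𝒞) : Ufin 𝒜 𝒞 :=
  fun 𝒰 h𝒰 => (h 𝒰 h𝒰).imp fun _ hℱ => ⟨hℱ.1, hs hℱ.2⟩

variable [TopologicalSpace X] [TopologicalSpace Y]

/-- One member of the first cover misses countably many points; the later covers catch these one at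
a time. -/
theorem sOne_odCovers_of_countable_compl [Nonempty X]
    (h : ∀ D : Set X, IsOpen D → Dense D → Dᶜ.Countable) :
    SOne (odCovers X) (openCovers X) := by
  intro 𝒰 h𝒰
  have hcov : ∀ n x, ∃ U ∈ 𝒰 n, x ∈ U := fun n x => mem_sUnion.1 ((h𝒰 n).1.2 ▸ mem_univ x)
  obtain ⟨x₀⟩ := ‹Nonempty X›
  obtain ⟨D, hD, -⟩ := hcov 0 x₀
  obtain ⟨e, he⟩ := ((h D ((h𝒰 0).1.1 D hD) ((h𝒰 0).2 D hD)).insert x₀).exists_eq_range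
    (insert_nonempty _ _)
  choose V hV hmem using fun n => hcov (n + 1) (e n)
  let U : ℕ → Set X := fun n => Nat.casesOn n D V
  have hU : ∀ n, U n ∈ 𝒰 n := fun n => by
    cases n with
    | zero => exact hD
    | succ n => exact hV n
  refine ⟨U, hU, ?_, eq_univ_of_forall fun x => ?_⟩
  · rintro _ ⟨n, rfl⟩
    exact (h𝒰 n).1.1 _ (hU n)
  · by_cases hx : x ∈ D
    · exact ⟨D, ⟨0, rfl⟩, hx⟩
    · obtain ⟨n, rfl⟩ : x ∈ range e := he ▸ mem_insert_of_mem x₀ hx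
      exact ⟨V n, ⟨n + 1, rfl⟩, hmem n⟩

/-- Preimages of dense sets under open maps are dense, and countably many images exhaust `Y`. -/
theorem countable_compl_of_isOpenMap {ι : Type*} [Countable ι] {f : ι → X → Y}
    (hc : ∀ i, Continuous (f i)) (ho : ∀ i, IsOpenMap (f i)) (hs : ∀ y, ∃ i x, f i x = y)
    (h : ∀ D : Set X, IsOpen D → Dense D → Dᶜ.Countable)
    (D : Set Y) (hD : IsOpen D) (hd : Dense D) : Dᶜ.Countable := by
  refine (countable_iUnion fun i =>
    (h _ (hD.preimage (hc i)) (hd.preimage (ho i))).image (f i)).mono fun y hy => ?_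
  obtain ⟨i, x, rfl⟩ := hs y
  exact mem_iUnion.2 ⟨i, mem_image_of_mem _ hy⟩

theorem openCovers_subset_weakCovers : openCovers X ⊆ weakCovers X := fun 𝒰 h𝒰 => by
  rw [weakCovers, mem_ofPred_eq, h𝒰.2]
  exact dense_univ

theorem lindelofSpace_prod_of_countable [LindelofSpace X] [Countable Y] :
    LindelofSpace (X × Y) := by
  refine isLindelof_univ_iff.1 ?_
  have : (univ : Set (X × Y)) = ⋃ y : Y, range fun x : X => (x, y) := by
    ext ⟨x, y⟩
    simp
  rw [this]
  exact isLindelof_iUnion fun y => isLindelof_range (by fun_prop)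

end Selection

/-! ### The limit layer and its complement in the product. -/

section ConvergentSequence

variable {X : Type*} [TopologicalSpace X] [Nonempty X]

theorem isODMengerSpace_prod_infty (h : ∀ D : Set X, IsOpen D → Dense D → Dᶜ.Countable) :
    IsODMengerSpace {p : X × OnePoint ℕ | p.2 = OnePoint.infty} := by
  let f : Unit → X → {p : X × OnePoint ℕ | p.2 = OnePoint.infty} := fun _ x =>
    ⟨(x, OnePoint.infty), rfl⟩
  have : Nonempty {p : X × OnePoint ℕ | p.2 = OnePoint.infty} := ‹Nonempty X›.map (f ())
  refine (sOne_odCovers_of_countable_compl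
    (countable_compl_of_isOpenMap (f := f) (fun _ => ?_) (fun _ U hU => ?_) ?_ h)).ufin
  · fun_prop
  · refine isOpen_induced_iff.2 ⟨Prod.fst ⁻¹' U, hU.preimage continuous_fst, ?_⟩
    ext ⟨⟨x, y⟩, hy⟩
    obtain rfl : y = OnePoint.infty := hy
    simp [f]
  · rintro ⟨⟨x, y⟩, hy⟩
    obtain rfl : y = OnePoint.infty := hy
    exact ⟨(), x, rfl⟩

theorem isODMengerSpace_prod_ne_infty (h : ∀ D : Set X, IsOpen D → Dense D → Dᶜ.Countable) :
    IsODMengerSpace {p : X × OnePoint ℕ | p.2 ≠ OnePoint.infty} := by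
  let f : ℕ → X → {p : X × OnePoint ℕ | p.2 ≠ OnePoint.infty} := fun n x =>
    ⟨(x, n), OnePoint.coe_ne_infty n⟩
  have : Nonempty {p : X × OnePoint ℕ | p.2 ≠ OnePoint.infty} := ‹Nonempty X›.map (f 0)
  refine (sOne_odCovers_of_countable_compl
    (countable_compl_of_isOpenMap (f := f) (fun n => ?_) (fun n U hU => ?_) ?_ h)).ufin
  · fun_prop
  · refine isOpen_induced_iff.2 ⟨U ×ˢ {(n : OnePoint ℕ)}, hU.prod ?_, ?_⟩
    · simpa using OnePoint.isOpenEmbedding_coe.isOpenMap {n} (isOpen_discrete _)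
    · ext ⟨⟨x, y⟩, hy⟩
      simp [f, eq_comm]
  · rintro ⟨⟨x, y⟩, hy⟩
    obtain ⟨n, rfl⟩ := OnePoint.ne_infty_iff_exists.1 hy
    exact ⟨n, x, rfl⟩

end ConvergentSequence

/-! ### Failure of the Menger-type properties. -/

namespace Hechler

variable {E : Type*} [TopologicalSpace E] {φ : E → Hechler}

theorem not_ufin_weakCovers (hφ : Continuous φ) (hm : ∀ x n, (φ ⁻¹' cone x n).Nonempty) :
    ¬ Ufin (openCovers E) (weakCovers E) := by
  intro h
  obtain ⟨ℱ, hℱ, hd⟩ := h (fun n => range fun k => {e | φ e n = k}) fun n => by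
    refine ⟨?_, eq_univ_of_forall fun e => ⟨_, ⟨φ e n, rfl⟩, rfl⟩⟩
    rintro _ ⟨k, rfl⟩
    exact (isOpen_discrete {k}).preimage ((continuous_coord n).comp hφ)
  obtain ⟨x, hx⟩ := exists_cone_forall_ne (fun n => (hℱ n).1) fun n => (hℱ n).2
  obtain ⟨e, he, -, ⟨n, rfl⟩, V, hV, heV⟩ :=
    Dense.inter_open_nonempty hd _ ((isOpen_cone x 0).preimage hφ) (hm x 0)
  obtain ⟨k, hk, rfl⟩ := hx _ he n V hV
  exact hk heV.symm

theorem not_isODMengerSpace_prod (hφ : Continuous φ) (hm : ∀ x n, (φ ⁻¹' cone x n).Nonempty) :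
    ¬ IsODMengerSpace (E × OnePoint ℕ) := by
  intro h
  let W : ℕ → ℕ → Set (E × OnePoint ℕ) := fun n k =>
    {p | p.2 ≠ OnePoint.infty} ∪ {p | φ p.1 n = k}
  have hfin : IsOpen {p : E × OnePoint ℕ | p.2 ≠ OnePoint.infty} :=
    isOpen_compl_singleton.preimage continuous_snd
  have hdense : Dense {p : E × OnePoint ℕ | p.2 ≠ OnePoint.infty} := by
    have := (dense_univ (X := E)).prod (OnePoint.denseRange_coe (X := ℕ))
    refine this.mono ?_
    rintro ⟨e, _⟩ ⟨-, n, rfl⟩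
    exact OnePoint.coe_ne_infty n
  obtain ⟨ℱ, hℱ, -, hcov⟩ := h (fun n => range (W n)) fun n => by
    refine ⟨⟨?_, eq_univ_of_forall fun p => ⟨_, ⟨φ p.1 n, rfl⟩, Or.inr rfl⟩⟩, ?_⟩
    · rintro _ ⟨k, rfl⟩
      exact hfin.union ((isOpen_discrete {k}).preimage
        ((continuous_coord n).comp (hφ.comp continuous_fst)))
    · rintro _ ⟨k, rfl⟩
      exact hdense.mono subset_union_left
  obtain ⟨x, hx⟩ := exists_cone_forall_ne (fun n => (hℱ n).1) fun n => (hℱ n).2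
  obtain ⟨e, he⟩ := hm x 0
  obtain ⟨-, ⟨n, rfl⟩, V, hV, heV⟩ : (e, OnePoint.infty) ∈ ⋃₀ range fun n => ⋃₀ ℱ n :=
    hcov ▸ mem_univ _
  obtain ⟨k, hk, rfl⟩ := hx _ he n V hV
  -- On the limit layer the added dense set is empty.
  exact heV.elim (fun h => h rfl) fun h => hk h.symm

end Hechler

/-- `τ` is a second topology on the subtype `E`. Being a local instance, it is the topology
used for `E` in every clause, except that `instTopologicalSpaceSubtype` is the Euclidean subspace
topology of `E`. The convergent sequence space `ω + 1` is the one-point compactification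
`OnePoint ℕ` of the discrete space `ℕ`. -/
theorem corollary3p5 (CH : Cardinal.continuum.{0} = Cardinal.aleph 1) :
    ∃ (E : Set ℝ) (τ : TopologicalSpace E),
      τ ≤ (instTopologicalSpaceSubtype : TopologicalSpace E) ∧
      HereditarilyLindelofSpace E ∧
      IsZeroDimensional E ∧
      FirstCountableTopology E ∧
      (SOne (odCovers E) (openCovers E) ∧ IsODMengerSpace E ∧
        ¬ Ufin (openCovers E) (weakCovers E) ∧ ¬ IsMengerSpace E) ∧
      (LindelofSpace (E × OnePoint ℕ) ∧
        (∃ A B : Set (E × OnePoint ℕ), A ∪ B = univ ∧ IsODMengerSpace A ∧ IsODMengerSpace B) ∧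
        ¬ IsODMengerSpace (E × OnePoint ℕ)) := by

  obtain ⟨S, hS, hSm⟩ := Hechler.exists_luzin_set CH
  obtain ⟨f, hf, hinj⟩ := Hechler.exists_continuous_injective_real
  let E : Set ℝ := f '' S
  -- `φ` inverts `f` on `E`; it pulls the Hechler topology back.
  choose φ hφS hφ using fun e : E => e.2
  have hφinj : Function.Injective φ := fun e e' h => Subtype.ext (by rw [← hφ e, h, hφ e'])
  let τ : TopologicalSpace E := TopologicalSpace.induced φ inferInstance
  have hind : Topology.IsInducing φ := ⟨rfl⟩
  have hL : ∀ D, IsOpen D → Dense D → (φ ⁻¹' Dᶜ).Countable := fun D hD hd =>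
    ((hS D hD hd).preimage hφinj).mono (show φ ⁻¹' Dᶜ ⊆ φ ⁻¹' (S \ D) from
      fun e he => ⟨hφS e, he⟩)
  have hm : ∀ x n, (φ ⁻¹' Hechler.cone x n).Nonempty := fun x n => by
    obtain ⟨y, hy, hyx⟩ := hSm x n
    refine ⟨⟨f y, mem_image_of_mem f hy⟩, ?_⟩
    rwa [mem_preimage, hinj (hφ ⟨f y, mem_image_of_mem f hy⟩)]
  have : Nonempty E := (hm (fun _ => 0 : ℕ → ℕ) 0).to_type
  have hlind := Hechler.hereditarilyLindelofSpace hind hL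
  have hcount : ∀ D : Set E, IsOpen D → Dense D → Dᶜ.Countable := fun D =>
    Hechler.countable_compl_of_dense hind hL
  have hweak := Hechler.not_ufin_weakCovers hind.continuous hm
  have hone := sOne_odCovers_of_countable_compl hcount
  refine ⟨E, τ, ?_, hlind, Hechler.isZeroDimensional_of_isInducing hind,
    TopologicalSpace.firstCountableTopology_induced _ _ φ,
    ⟨hone, hone.ufin, hweak, fun h => hweak (h.of_subset openCovers_subset_weakCovers)⟩,
    ?_, ⟨_, _, ?_, isODMengerSpace_prod_infty hcount, isODMengerSpace_prod_ne_infty hcount⟩,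
    Hechler.not_isODMengerSpace_prod hind.continuous hm⟩
  · refine continuous_iff_le_induced.1 ?_
    rw [show (Subtype.val : E → ℝ) = f ∘ φ from funext fun e => (hφ e).symm]
    exact hf.comp hind.continuous
  · have : Countable (OnePoint ℕ) := inferInstanceAs (Countable (Option ℕ))
    exact lindelofSpace_prod_of_countable
  · exact eq_univ_of_forall fun p => em _
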